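/- Let $c,r,\mu,\sigma,\sigma_1,\lambda,m,A>0$ and $\rho\in(-1,1)$. For a $C^2$ function $W$ on $[0,\infty)$ (one-sided derivatives at $0$), $a\in\mathbb R$ and $x\ge 0$ put $$\mathcal L^{(a)}W(x)=\tfrac12(\sigma^2a^2+2\rho\sigma\sigma_1a+\sigma_1^2)W''(x)+[c+(\mu-r)a+rx]W'(x)-\lambda\Big[W(x)-\int_0^xW(x-s)\,dF(s)\Big],$$ where $F$ is the exponential distribution with mean $m$ (the claim size distribution). Let $V$ be a $C^2$ solution on $[0,\infty)$ of the Hamilton–Jacobi–Bellman equation $\sup_{0\le a\le A}\mathcal L^{(a)}V(x)=0$, $x\ge0$, with $V(0)=0$ and $V'(0+)=1$. Define $a_V(x)=-\frac{(\mu-r)V'(x)}{\sigma^2V''(x)}-\rho\frac{\sigma_1}{\sigma}$ where $V''(x)\neq0$, and let the optimal investment $a^*_V(x)$ be: if $V''(x)<0$, the projection of $a_V(x)$ onto $[0,A]$; if $V''(x)>0$, the value $0$ when $a_V(x)\ge A/2$ and $A$ when $a_V(x)<A/2$; if $V''(x)=0$, the value $A$. Put $q=\frac{(\mu-r)m}{\sigma^2}-\rho\frac{\sigma_1}{\sigma}$.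 Then for all sufficiently large $x$, $a_V^*(x)$ is the unique maximizer of $a\mapsto\mathcal L^{(a)}V(x)$ on $[0,A]$, and: - if $0\le q\le A$, then $a^*_V(x)=q+O(1/x)$ as $x\to\infty$; - if $q<0$, then $a^*_V(x)=0$ for all sufficiently large $x$; - if $q>A$, then $a^*_V(x)=A$ for all sufficiently large $x$; - if $0<q<A$, then moreover $$a^*_V(x)=q-\Big(1-\frac{\lambda}{r}\Big)\frac{(\mu-r)m^2}{\sigma^2}\,\frac1x+o\Big(\frac1x\Big),\qquad x\to\infty.$$ -/

import Mathlib

open Set Filter Topology MeasureTheory ProbabilityTheory Asymptotics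

noncomputable section

/-- Parameters of the perturbed Cramér–Lundberg model with investment, with the standing
assumptions: `c` premium rate, `r` interest rate, `μ`, `σ` return and volatility of the stock,
`σ₁` volatility of the Brownian perturbation, `ρ` the correlation of the two Brownian motions,
`lam` the claim intensity, `A` the upper bound for the amount invested in the stock. -/
structure RiskModel where
  c : ℝ
  r : ℝ
  μ : ℝ
  σ : ℝ
  σ₁ : ℝ
  ρ : ℝ
  lam : ℝ
  A : ℝ
  c_pos : 0 < c
  r_pos : 0 < r
  μ_pos : 0 < μ
  σ_pos : 0 < σ
  σ₁_pos : 0 < σ₁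
  abs_ρ_lt_one : |ρ| < 1
  lam_pos : 0 < lam
  A_pos : 0 < A

/-- First derivative on `[0,∞)` (one-sided at `0`). -/
def D1 (W : ℝ → ℝ) : ℝ → ℝ := derivWithin W (Ici 0)

/-- Second derivative on `[0,∞)` (one-sided at `0`). -/
def D2 (W : ℝ → ℝ) : ℝ → ℝ := derivWithin (derivWithin W (Ici 0)) (Ici 0)

namespace RiskModel

/-- `M(W)(x) = λ [W(x) - ∫₀ˣ W(x - s) dF(s)]`, where `F` is the law of the claims. -/
def M (P : RiskModel) (F : Measure ℝ) (W : ℝ → ℝ) (x : ℝ) : ℝ :=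
  P.lam * (W x - ∫ s in Icc 0 x, W (x - s) ∂F)

/-- The generator `𝓛^{(a)} W (x)` of the surplus when the amount `a` is held in the stock. -/
def gen (P : RiskModel) (F : Measure ℝ) (a : ℝ) (W : ℝ → ℝ) (x : ℝ) : ℝ :=
  1 / 2 * (P.σ ^ 2 * a ^ 2 + 2 * P.ρ * P.σ * P.σ₁ * a + P.σ₁ ^ 2) * D2 W x
    + (P.c + (P.μ - P.r) * a + P.r * x) * D1 W x - P.M F W x

/-- `V` is a classical solution on `[0,∞)` of the Hamilton–Jacobi–Bellman equation
`sup_{0 ≤ a ≤ A} 𝓛^{(a)} V (x) = 0`, normalized by `V(0) = 0`, `V'(0+) = 1`. -/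
structure IsHJBSolution (P : RiskModel) (F : Measure ℝ) (V : ℝ → ℝ) : Prop where
  contDiffOn : ContDiffOn ℝ 2 V (Ici 0)
  zero : V 0 = 0
  deriv_zero : D1 V 0 = 1
  hjb : ∀ x, 0 ≤ x → IsLUB ((fun a => P.gen F a V x) '' Icc 0 P.A) 0

/-- The unconstrained critical point `a_W(x)` of `a ↦ 𝓛^{(a)} W (x)` (for `W''(x) ≠ 0`). -/
def aCrit (P : RiskModel) (W : ℝ → ℝ) (x : ℝ) : ℝ :=
  -((P.μ - P.r) * D1 W x) / (P.σ ^ 2 * D2 W x) - P.ρ * (P.σ₁ / P.σ)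

open Classical in
/-- The optimal investment `a*_W(x)` under the constraint `0 ≤ a ≤ A`. -/
def aStar (P : RiskModel) (W : ℝ → ℝ) (x : ℝ) : ℝ :=
  if D2 W x < 0 then
    if P.aCrit W x ≤ 0 then 0
    else if P.A ≤ P.aCrit W x then P.A
    else P.aCrit W x
  else if 0 < D2 W x then
    if P.A / 2 ≤ P.aCrit W x then 0 else P.A
  else P.A

/-- `q = (μ - r) m / σ² - ρ σ₁ / σ`. -/
def q (P : RiskModel) (m : ℝ) : ℝ :=
  (P.μ - P.r) * m / P.σ ^ 2 - P.ρ * (P.σ₁ / P.σ)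

end RiskModel

end

/-!
Dividing the Hamilton–Jacobi–Bellman equation by `V'` turns it into `λ h = r x + c + Φ(u)`, where
`u = V'' / V'`, `h(x) = (V(x) - ∫₀ˣ V(x - s) dF(s)) / V'(x)` and `Φ(u)` is a supremum of affine
functions of `u` with slopes in a compact subset of `(0, ∞)`. For exponential claims with rate
`k = 1 / m` one has `h' = 1 - h (u + k)`. The deviation of `λ h` from the line
`r x + c + Φ(-k)` is `u + k` times a slope of `Φ`, so it solves a linear relaxation equation whose
rate grows with `h`. Hence it tends to `0`, that is, `u → -k`. As `Φ` is differentiable at `-k`, the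
slope then converges, and the same argument for `x` times the deviation gives
`x (u + k) → λ / r - 1`. Finally `a_V` is a smooth function of `u` that takes the value `q` at `-k`
and has derivative `(μ - r) m² / σ²` there.
-/

section Relaxation

variable {y y' w ℓ : ℝ → ℝ} {B η w₀ L : ℝ}

theorem exists_ge_le_of_deriv_le_neg {x₀ : ℝ} (hη : 0 < η)
    (hd : ∀ x ≥ x₀, HasDerivAt y (y' x) x) (hb : ∀ x ≥ x₀, B ≤ y x → y' x ≤ -η) :
    ∃ x ≥ x₀, y x ≤ B := by
  by_contra! habove
  set T := x₀ + (y x₀ - B) / η with hT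
  have hx₀T : x₀ ≤ T :=
    le_add_of_nonneg_right (div_nonneg (sub_nonneg.2 (habove x₀ le_rfl).le) hη.le)
  have hdrop : y T - y x₀ ≤ -η * (T - x₀) := by
    refine (convex_Ici x₀).image_sub_le_mul_sub_of_deriv_le
      (fun x hx => (hd x hx).continuousAt.continuousWithinAt)
      (fun x hx => (hd x (interior_subset hx)).differentiableAt.differentiableWithinAt)
      (fun x hx => ?_) x₀ self_mem_Ici T hx₀T hx₀T
    have hx₀x : x₀ ≤ x := interior_subset hx
    exact (hd x hx₀x).deriv.trans_le (hb x hx₀x (habove x hx₀x).le)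
  have htime : η * (T - x₀) = y x₀ - B := by
    rw [hT, add_sub_cancel_left, mul_div_cancel₀ _ hη.ne']
  linarith [habove T hx₀T]

theorem eventually_le_of_deriv_le_neg (hη : 0 < η)
    (hd : ∀ᶠ x in atTop, HasDerivAt y (y' x) x)
    (hb : ∀ᶠ x in atTop, B ≤ y x → y' x ≤ -η) : ∀ᶠ x in atTop, y x ≤ B := by
  obtain ⟨x₀, hx₀⟩ := eventually_atTop.1 (hd.and hb)
  obtain ⟨x₁, hx₀₁, hyx₁⟩ := exists_ge_le_of_deriv_le_neg hη (fun x hx => (hx₀ x hx).1)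
    fun x hx => (hx₀ x hx).2
  filter_upwards [eventually_ge_atTop x₁] with x hx
  exact image_le_of_deriv_right_lt_deriv_boundary (B' := fun _ => 0)
    (fun z hz => (hx₀ z (hx₀₁.le.trans hz.1)).1.continuousAt.continuousWithinAt)
    (fun z hz => (hx₀ z (hx₀₁.le.trans hz.1)).1.hasDerivWithinAt) hyx₁
    (fun z => hasDerivAt_const z B)
    (fun z hz hyz => ((hx₀ z (hx₀₁.le.trans hz.1)).2 hyz.ge).trans_lt (neg_neg_of_pos hη))
    (right_mem_Icc.2 hx)

theorem eventually_ge_of_le_deriv (hη : 0 < η)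
    (hd : ∀ᶠ x in atTop, HasDerivAt y (y' x) x)
    (hb : ∀ᶠ x in atTop, y x ≤ B → η ≤ y' x) : ∀ᶠ x in atTop, B ≤ y x := by
  have hneg : ∀ᶠ x in atTop, -y x ≤ -B :=
    eventually_le_of_deriv_le_neg hη (hd.mono fun x hx => hx.neg)
      (hb.mono fun x hx hyx => neg_le_neg (hx (neg_le_neg_iff.1 hyx)))
  exact hneg.mono fun x hx => neg_le_neg_iff.1 hx

theorem eventually_lt_of_hasDerivAt_relaxation (hw₀ : 0 < w₀)
    (hd : ∀ᶠ x in atTop, HasDerivAt y (w x * (ℓ x - y x)) x) (hw : ∀ᶠ x in atTop, w₀ ≤ w x)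
    (hℓ : Tendsto ℓ atTop (𝓝 L)) {a : ℝ} (ha : L < a) : ∀ᶠ x in atTop, y x < a := by
  obtain ⟨b, hLb, hba⟩ := exists_between ha
  obtain ⟨b', hLb', hb'b⟩ := exists_between hLb
  have hle : ∀ᶠ x in atTop, y x ≤ b := by
    refine eventually_le_of_deriv_le_neg (mul_pos hw₀ (sub_pos.2 hb'b)) hd ?_
    filter_upwards [hw, hℓ.eventually_lt_const hLb'] with x hwx hℓx hyx
    calc w x * (ℓ x - y x) ≤ w₀ * (ℓ x - y x) :=
          mul_le_mul_of_nonpos_right hwx (by linarith)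
      _ ≤ w₀ * -(b - b') := by gcongr; linarith
      _ = -(w₀ * (b - b')) := mul_neg _ _
  exact hle.mono fun x hx => hx.trans_lt hba

theorem tendsto_of_hasDerivAt_relaxation (hw₀ : 0 < w₀)
    (hd : ∀ᶠ x in atTop, HasDerivAt y (w x * (ℓ x - y x)) x) (hw : ∀ᶠ x in atTop, w₀ ≤ w x)
    (hℓ : Tendsto ℓ atTop (𝓝 L)) : Tendsto y atTop (𝓝 L) := by
  refine tendsto_order.2 ⟨fun a ha => ?_, fun a ha =>
    eventually_lt_of_hasDerivAt_relaxation hw₀ hd hw hℓ ha⟩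
  have hneg : ∀ᶠ x in atTop, -y x < -a :=
    eventually_lt_of_hasDerivAt_relaxation (y := fun x => -y x) (ℓ := fun x => -ℓ x) hw₀
      (hd.mono fun x hx => hx.neg.congr_deriv (by ring)) hw hℓ.neg (neg_lt_neg ha)
  exact hneg.mono fun x hx => neg_lt_neg_iff.1 hx

end Relaxation

/-- The equation `h' = 1 - h g`, in which `g` measures, up to the slope `s ∈ [δ, S]`, how far `l h`
is from the line `r x + C`. The Hamilton–Jacobi–Bellman equation takes this form for
`h = (V - ∫₀ˣ V(x - s) dF(s)) / V'` and `g = V'' / V' + k`. -/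
structure IsTrackingSystem (l r C δ S : ℝ) (h g s : ℝ → ℝ) : Prop where
  hasDerivAt : ∀ᶠ x in atTop, HasDerivAt h (1 - h x * g x) x
  pos : ∀ᶠ x in atTop, 0 < h x
  balance : ∀ᶠ x in atTop, l * h x = r * x + C + s x * g x
  slope_mem : ∀ᶠ x in atTop, s x ∈ Icc δ S

namespace IsTrackingSystem

variable {l r C δ S κ : ℝ} {h g s : ℝ → ℝ}

theorem tendsto_atTop (H : IsTrackingSystem l r C δ S h g s) (hl : 0 < l) (hr : 0 < r)
    (hδ : 0 < δ) : Tendsto h atTop atTop := by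
  have hline : Tendsto (fun x => r * x + C) atTop atTop :=
    tendsto_atTop_add_const_right _ C (tendsto_id.const_mul_atTop hr)
  refine Filter.tendsto_atTop.2 fun B => eventually_ge_of_le_deriv one_pos H.hasDerivAt ?_
  filter_upwards [H.pos, H.balance, H.slope_mem, hline.eventually_ge_atTop (l * B)]
    with x hpos hbal hs hx hhB
  have hlh : l * h x ≤ l * B := by gcongr
  have hg : g x ≤ 0 := nonpos_of_mul_nonpos_right (a := s x) (by linarith) (hδ.trans_le hs.1)
  linarith [mul_nonpos_of_nonneg_of_nonpos hpos.le hg]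

theorem hasDerivAt_deviation (H : IsTrackingSystem l r C δ S h g s) (hl : 0 < l) (hδ : 0 < δ) :
    ∀ᶠ x in atTop, HasDerivAt (fun x => l * h x - r * x - C)
      (l * h x / s x * ((l - r) * s x / (l * h x) - (l * h x - r * x - C))) x := by
  filter_upwards [H.hasDerivAt, H.pos, H.balance, H.slope_mem] with x hd hpos hbal hs
  have hsx : s x ≠ 0 := (hδ.trans_le hs.1).ne'
  refine (((hd.const_mul l).sub ((hasDerivAt_id x).const_mul r)).sub_const C).congr_deriv ?_
  rw [show l * h x - r * x - C = s x * g x by linarith]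
  field_simp
  ring

theorem tendsto_deviation (H : IsTrackingSystem l r C δ S h g s) (hl : 0 < l) (hr : 0 < r)
    (hδ : 0 < δ) : Tendsto (fun x => l * h x - r * x - C) atTop (𝓝 0) := by
  have hlh : Tendsto (fun x => l * h x) atTop atTop := (H.tendsto_atTop hl hr hδ).const_mul_atTop hl
  refine tendsto_of_hasDerivAt_relaxation one_pos (H.hasDerivAt_deviation hl hδ) ?_ ?_
  · filter_upwards [H.slope_mem, hlh.eventually_ge_atTop S] with x hs hx
    exact (one_le_div (hδ.trans_le hs.1)).2 (hs.2.trans hx)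
  · have hbdd : IsBoundedUnder (· ≤ ·) atTop fun x => |(l - r) * s x| := by
      refine isBoundedUnder_of_eventually_le (a := |l - r| * S) ?_
      filter_upwards [H.slope_mem] with x hs
      rw [abs_mul, abs_of_pos (hδ.trans_le hs.1)]
      gcongr
      exact hs.2
    exact (hlh.inv_tendsto_atTop.zero_mul_isBoundedUnder_le hbdd).congr fun x =>
      (div_eq_inv_mul _ _).symm

theorem tendsto_zero (H : IsTrackingSystem l r C δ S h g s) (hl : 0 < l) (hr : 0 < r)
    (hδ : 0 < δ) : Tendsto g atTop (𝓝 0) := by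
  have hbound : Tendsto (fun x => |l * h x - r * x - C| / δ) atTop (𝓝 0) := by
    simpa using (H.tendsto_deviation hl hr hδ).abs.div_const δ
  refine squeeze_zero_norm' ?_ hbound
  filter_upwards [H.balance, H.slope_mem] with x hbal hs
  rw [show l * h x - r * x - C = s x * g x by linarith, abs_mul, abs_of_pos (hδ.trans_le hs.1),
    Real.norm_eq_abs, le_div_iff₀' hδ]
  gcongr
  exact hs.1

theorem tendsto_div_id (H : IsTrackingSystem l r C δ S h g s) (hl : 0 < l) (hr : 0 < r)
    (hδ : 0 < δ) : Tendsto (fun x => l * h x / x) atTop (𝓝 r) := by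
  have hlim := (((H.tendsto_deviation hl hr hδ).add_const C).mul tendsto_inv_atTop_zero).const_add r
  rw [mul_zero, add_zero] at hlim
  refine hlim.congr' ?_
  filter_upwards [eventually_gt_atTop 0] with x hx
  field_simp
  ring

/-- The relaxation rate of `x e(x)`, `e = l h - (r x + C)`, is `x β(x)` with
`β = l h / (x s) - 1 / x²`. -/
theorem tendsto_mul_deviation (H : IsTrackingSystem l r C δ S h g s) (hl : 0 < l) (hr : 0 < r)
    (hδ : 0 < δ) (hκ : 0 < κ) (hs : Tendsto s atTop (𝓝 κ)) :
    Tendsto (fun x => x * (l * h x - r * x - C)) atTop (𝓝 ((l - r) / (r / κ))) := by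
  set β : ℝ → ℝ := fun x => l * h x / x / s x - (x ^ 2)⁻¹ with hβ_def
  have hβ : Tendsto β atTop (𝓝 (r / κ)) := by
    simpa using ((H.tendsto_div_id hl hr hδ).div hs hκ.ne').sub
      (tendsto_pow_atTop two_ne_zero).inv_tendsto_atTop
  have hrκ : 0 < r / κ := div_pos hr hκ
  refine tendsto_of_hasDerivAt_relaxation (w := fun x => x * β x) (ℓ := fun x => (l - r) / β x)
    one_pos ?_ ((tendsto_id.atTop_mul_pos hrκ hβ).eventually_ge_atTop 1)
    (tendsto_const_nhds.div hβ hrκ.ne')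
  filter_upwards [H.hasDerivAt_deviation hl hδ, H.pos, H.slope_mem, eventually_gt_atTop 0,
    hβ.eventually_const_lt hrκ] with x hd hpos hsx hx hβx
  have hsx₀ : s x ≠ 0 := (hδ.trans_le hsx.1).ne'
  refine ((hasDerivAt_id x).mul hd).congr_deriv ?_
  rw [mul_assoc x, mul_sub (β x), mul_div_cancel₀ _ hβx.ne', hβ_def, id]
  field_simp
  ring

theorem tendsto_mul (H : IsTrackingSystem l r C δ S h g s) (hl : 0 < l) (hr : 0 < r)
    (hδ : 0 < δ) (hs : Tendsto s atTop (𝓝 κ)) :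
    Tendsto (fun x => x * g x) atTop (𝓝 (l / r - 1)) := by
  have hκ : 0 < κ := hδ.trans_le (ge_of_tendsto hs (H.slope_mem.mono fun x hx => hx.1))
  have hlim := (H.tendsto_mul_deviation hl hr hδ hκ hs).div hs hκ.ne'
  rw [show (l - r) / (r / κ) / κ = l / r - 1 by field_simp] at hlim
  refine hlim.congr' ?_
  filter_upwards [H.balance, H.slope_mem] with x hbal hsx
  have hsx₀ : s x ≠ 0 := (hδ.trans_le hsx.1).ne'
  rw [Pi.div_apply, show l * h x - r * x - C = s x * g x by linarith]
  field_simp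

end IsTrackingSystem

section FirstZero

theorem eventually_lt_nhdsLT_of_hasDerivAt_pos {f : ℝ → ℝ} {f' z : ℝ} (hf : HasDerivAt f f' z)
    (hf' : 0 < f') : ∀ᶠ y in 𝓝[<] z, f y < f z := by
  have hslope : ∀ᶠ y in 𝓝[<] z, 0 < slope f z y :=
    ((hasDerivAt_iff_tendsto_slope.1 hf).mono_left
      (nhdsWithin_mono _ fun _ hy => ne_of_lt hy)).eventually_const_lt hf'
  filter_upwards [hslope, self_mem_nhdsWithin] with y hy hyz
  rw [slope_comm, slope_def_field, div_pos_iff_of_pos_right (sub_pos.2 hyz)] at hy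
  exact sub_pos.1 hy

theorem pos_of_deriv_pos_at_first_zero {f f' : ℝ → ℝ} (hfc : ContinuousOn f (Ici 0))
    (hf : ∀ z > 0, HasDerivAt f (f' z) z) (hf₀ : 0 < f 0)
    (hzero : ∀ z > 0, (∀ y ∈ Ico 0 z, 0 < f y) → f z = 0 → 0 < f' z) {x : ℝ} (hx : 0 ≤ x) :
    0 < f x := by
  by_contra! hfx
  have hcompact : IsCompact (Icc 0 x ∩ f ⁻¹' Iic 0) :=
    isCompact_Icc.of_isClosed_subset
      ((hfc.mono Icc_subset_Ici_self).preimage_isClosed_of_isClosed isClosed_Icc isClosed_Iic)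
      inter_subset_left
  obtain ⟨z, ⟨⟨hz₀, hzx⟩, hfz : f z ≤ 0⟩, hzmin⟩ :=
    hcompact.exists_isLeast ⟨x, right_mem_Icc.2 hx, hfx⟩
  have hz : 0 < z := hz₀.lt_of_ne (by rintro rfl; exact hfz.not_gt hf₀)
  have hbefore : ∀ y ∈ Ico 0 z, 0 < f y := fun y hy =>
    not_le.1 fun hfy => (hzmin ⟨⟨hy.1, hy.2.le.trans hzx⟩, hfy⟩).not_gt hy.2
  have hleft : ∀ᶠ y in 𝓝[<] z, 0 < f y := mem_of_superset (Ico_mem_nhdsLT hz) hbefore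
  have hfz₀ : f z = 0 := hfz.antisymm <| ge_of_tendsto
    ((hf z hz).continuousAt.tendsto.mono_left nhdsWithin_le_nhds) (hleft.mono fun y hy => hy.le)
  obtain ⟨y, hy_pos, hy_neg⟩ := (hleft.and (eventually_lt_nhdsLT_of_hasDerivAt_pos (hf z hz)
    (hzero z hz hbefore hfz₀))).exists
  exact lt_asymm hy_pos (hfz₀ ▸ hy_neg)

end FirstZero

/-- `W(x) - ∫₀ˣ W(x - s) dF(s)`: the expected drop of `W` caused by a claim with law `F` at surplus
`x`, where `W` is read as `0` after ruin. -/
noncomputable def claimDrop (F : Measure ℝ) (W : ℝ → ℝ) (x : ℝ) : ℝ :=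
  W x - ∫ s in Icc 0 x, W (x - s) ∂F

section ClaimDrop

variable {k : ℝ} {W : ℝ → ℝ}

theorem claimDrop_zero {F : Measure ℝ} (hW₀ : W 0 = 0) : claimDrop F W 0 = 0 := by
  simp [claimDrop, hW₀]

theorem setIntegral_Icc_expMeasure (hk : 0 < k) (f : ℝ → ℝ) (x : ℝ) :
    ∫ s in Icc 0 x, f s ∂(expMeasure k) = ∫ s in Icc 0 x, k * Real.exp (-(k * s)) * f s := by
  have hmeas : Measurable (gammaPDF 1 k) := (measurable_gammaPDFReal 1 k).ennreal_ofReal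
  rw [expMeasure, gammaMeasure, setIntegral_withDensity_eq_setIntegral_toReal_smul₀
    hmeas.aemeasurable (Eventually.of_forall fun _ => ENNReal.ofReal_lt_top) _ measurableSet_Icc]
  refine setIntegral_congr_fun measurableSet_Icc fun s hs => ?_
  have hpdf : gammaPDF 1 k s = ENNReal.ofReal (k * Real.exp (-(k * s))) :=
    exponentialPDF_of_nonneg hs.1
  rw [hpdf, ENNReal.toReal_ofReal (by positivity), smul_eq_mul]

/-- Substituting `y = x - s`. Reading `W` at `max y 0` changes nothing on `[0, x]` and makes the
integrand continuous on the whole line when `W` is continuous on `[0, ∞)` only. -/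
theorem claimDrop_expMeasure (hk : 0 < k) (W : ℝ → ℝ) {x : ℝ} (hx : 0 ≤ x) :
    claimDrop (expMeasure k) W x = W x - Real.exp (-(k * x)) *
      ∫ y in (0 : ℝ)..x, W (max y 0) * (k * Real.exp (k * y)) := by
  have hsubst := intervalIntegral.integral_comp_sub_left (a := 0) (b := x)
    (fun y => k * Real.exp (-(k * (x - y))) * W y) x
  simp only [sub_sub_cancel, sub_self, sub_zero] at hsubst
  rw [claimDrop, setIntegral_Icc_expMeasure hk, integral_Icc_eq_integral_Ioc,
    ← intervalIntegral.integral_of_le hx, hsubst, ← intervalIntegral.integral_const_mul]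
  congr 1
  refine intervalIntegral.integral_congr fun y hy => ?_
  rw [uIcc_of_le hx] at hy
  simp only [max_eq_left hy.1]
  rw [show -(k * (x - y)) = -(k * x) + k * y by ring, Real.exp_add]
  ring

theorem hasDerivAt_integral_comp_max_mul_exp (hW : ContinuousOn W (Ici 0)) (x : ℝ) :
    HasDerivAt (fun x => ∫ y in (0 : ℝ)..x, W (max y 0) * (k * Real.exp (k * y)))
      (W (max x 0) * (k * Real.exp (k * x))) x := by
  have hWmax : Continuous fun y => W (max y 0) :=
    hW.comp_continuous (by fun_prop) fun y => le_max_right y 0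
  have hcont : Continuous fun y => W (max y 0) * (k * Real.exp (k * y)) :=
    hWmax.mul (by fun_prop)
  exact (hcont.integral_hasStrictDerivAt 0 x).hasDerivAt

theorem continuousOn_claimDrop_expMeasure (hk : 0 < k) (hW : ContinuousOn W (Ici 0)) :
    ContinuousOn (claimDrop (expMeasure k) W) (Ici 0) := by
  refine ContinuousOn.congr (hW.sub (ContinuousOn.mul (by fun_prop) fun x _ => ?_))
    fun x hx => claimDrop_expMeasure hk W hx
  exact (hasDerivAt_integral_comp_max_mul_exp hW x).continuousAt.continuousWithinAt

theorem hasDerivAt_claimDrop_expMeasure (hk : 0 < k) (hW : ContinuousOn W (Ici 0)) {x W' : ℝ}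
    (hx : 0 < x) (hW' : HasDerivAt W W' x) :
    HasDerivAt (claimDrop (expMeasure k) W) (W' - k * claimDrop (expMeasure k) W x) x := by
  have hexp : HasDerivAt (fun x => Real.exp (-(k * x))) (Real.exp (-(k * x)) * -(k * 1)) x :=
    ((hasDerivAt_id x).const_mul k).neg.exp
  have heq : claimDrop (expMeasure k) W =ᶠ[𝓝 x] fun x => W x - Real.exp (-(k * x)) *
      ∫ y in (0 : ℝ)..x, W (max y 0) * (k * Real.exp (k * y)) := by
    filter_upwards [lt_mem_nhds hx] with y hy using claimDrop_expMeasure hk W hy.le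
  refine ((hW'.sub (hexp.mul (hasDerivAt_integral_comp_max_mul_exp (k := k) hW x))).congr_deriv
    ?_).congr_of_eventuallyEq heq
  have hcancel : Real.exp (-(k * x)) * Real.exp (k * x) = 1 := by rw [← Real.exp_add]; simp
  rw [claimDrop_expMeasure hk W hx.le, max_eq_left hx.le]
  linear_combination (-(W x) * k) * hcancel

/-- `x ↦ e^{kx} claimDrop(x)` has derivative `e^{kx} W'(x)`. -/
theorem claimDrop_expMeasure_pos (hk : 0 < k) {W' : ℝ → ℝ} (hW : ContinuousOn W (Ici 0))
    (hW₀ : W 0 = 0) (hd : ∀ x > 0, HasDerivAt W (W' x) x) {x : ℝ} (hx : 0 < x)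
    (hW' : ∀ y ∈ Ioo 0 x, 0 < W' y) : 0 < claimDrop (expMeasure k) W x := by
  have hder : ∀ y > 0, HasDerivAt (fun y => claimDrop (expMeasure k) W y * Real.exp (k * y))
      (W' y * Real.exp (k * y)) y := fun y hy =>
    ((hasDerivAt_claimDrop_expMeasure hk hW hy (hd y hy)).mul
      ((hasDerivAt_id y).const_mul k).exp).congr_deriv (by simp only [id]; ring)
  have hmono : StrictMonoOn (fun y => claimDrop (expMeasure k) W y * Real.exp (k * y))
      (Icc 0 x) := by
    refine strictMonoOn_of_deriv_pos (convex_Icc 0 x)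
      (((continuousOn_claimDrop_expMeasure hk hW).mono Icc_subset_Ici_self).mul (by fun_prop))
      fun y hy => ?_
    rw [interior_Icc] at hy
    rw [(hder y hy.1).deriv]
    exact mul_pos (hW' y hy) (Real.exp_pos _)
  have hlt := hmono (left_mem_Icc.2 hx.le) (right_mem_Icc.2 hx.le) hx
  simp only [claimDrop_zero hW₀, zero_mul] at hlt
  exact pos_of_mul_pos_left hlt (Real.exp_pos _).le

end ClaimDrop

section ConvexCalculus

theorem hasDerivAt_of_continuousAt_subgradient {f p : ℝ → ℝ} {u : ℝ}
    (hp : ∀ᶠ v in 𝓝 u, ∀ w, p v * (w - v) ≤ f w - f v) (hpc : ContinuousAt p u) :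
    HasDerivAt f (p u) u := by
  have hpu : ∀ w, p u * (w - u) ≤ f w - f u := hp.self_of_nhds
  have hp₀ : (fun v => p v - p u) =o[𝓝 u] fun _ => (1 : ℝ) :=
    (isLittleO_one_iff ℝ).2 (tendsto_sub_nhds_zero_iff.2 hpc)
  refine hasDerivAt_iff_isLittleO.2 (IsBigO.trans_isLittleO (.of_bound 1 ?_)
    (by simpa using hp₀.mul_isBigO (isBigO_refl (fun v => v - u) (𝓝 u))))
  filter_upwards [hp] with v hv
  rw [one_mul, smul_eq_mul]
  refine abs_le_abs_of_nonneg ?_ ?_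
  · linarith [hpu v]
  · linarith [hv u]

theorem tendsto_mul_comp_sub {f : ℝ → ℝ} {f' a d : ℝ} {u : ℝ → ℝ} (hf : HasDerivAt f f' a)
    (hu : Tendsto u atTop (𝓝 a)) (hxu : Tendsto (fun x => x * (u x - a)) atTop (𝓝 d)) :
    Tendsto (fun x => x * (f (u x) - f a)) atTop (𝓝 (d * f')) := by
  simpa using (hasDerivAt_iff_hasFDerivAt.1 hf).hasFDerivWithinAt (s := univ) |>.lim
    (tendsto_sub_nhds_zero_iff.2 hu) (by simp) hxu

theorem abs_projIcc_sub_lt_abs_sub {a b t z : ℝ} (h : a ≤ b) (hz : z ∈ Icc a b)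
    (hne : z ≠ projIcc a b h t) : |projIcc a b h t - t| < |z - t| := by
  rcases le_total t a with hta | hat
  · rw [projIcc_of_le_left h hta] at hne ⊢
    have hlt : a < z := hz.1.lt_of_ne' hne
    rw [abs_of_nonneg (sub_nonneg.2 hta), abs_of_nonneg (by linarith)]
    linarith
  rcases le_total b t with hbt | htb
  · rw [projIcc_of_right_le h hbt] at hne ⊢
    have hlt : z < b := hz.2.lt_of_ne hne
    rw [abs_of_nonpos (sub_nonpos.2 hbt), abs_of_nonpos (by linarith)]
    linarith
  · rw [projIcc_of_mem h ⟨hat, htb⟩] at hne ⊢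
    simpa [sub_eq_zero] using hne

end ConvexCalculus

namespace RiskModel

variable (P : RiskModel)

/-- Half the squared volatility of the surplus when the amount `a` is held in the stock. -/
noncomputable def halfVar (a : ℝ) : ℝ :=
  1 / 2 * (P.σ ^ 2 * a ^ 2 + 2 * P.ρ * P.σ * P.σ₁ * a + P.σ₁ ^ 2)

/-- The part of `𝓛^{(a)} V (x) / V'(x)` that depends on `a`, as a function of
`u = V''(x) / V'(x)`. -/
noncomputable def investmentGain (u a : ℝ) : ℝ :=
  P.halfVar a * u + (P.μ - P.r) * a

/-- The gain from investing optimally, as a function of `u = V'' / V'`; the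
Hamilton–Jacobi–Bellman equation sees `u` only through this convex function. -/
noncomputable def hamiltonian (u : ℝ) : ℝ :=
  sSup (P.investmentGain u '' Icc 0 P.A)

/-- The critical point of `P.investmentGain u`, for `u ≠ 0`; it equals `a_V(x)` at
`u = V''(x) / V'(x)`. -/
noncomputable def critInvestment (u : ℝ) : ℝ :=
  -(P.μ - P.r) / (P.σ ^ 2 * u) - P.ρ * (P.σ₁ / P.σ)

/-- The projection of the critical point onto `[0, A]`, which maximizes `P.investmentGain u` there
when `u < 0`. -/
noncomputable def optInvestment (u : ℝ) : ℝ :=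
  projIcc 0 P.A P.A_pos.le (P.critInvestment u)

theorem nonempty_Icc_A : (Icc 0 P.A).Nonempty :=
  nonempty_Icc.2 P.A_pos.le

theorem continuous_halfVar : Continuous P.halfVar := by
  unfold halfVar; fun_prop

theorem continuous_investmentGain (u : ℝ) : Continuous (P.investmentGain u) :=
  (P.continuous_halfVar.mul_const u).add (continuous_const_mul _)

theorem halfVar_pos (a : ℝ) : 0 < P.halfVar a := by
  have hρ : 0 < 1 - P.ρ ^ 2 := sub_pos.2 ((sq_lt_one_iff_abs_lt_one _).2 P.abs_ρ_lt_one)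
  have hσ₁ := P.σ₁_pos
  have hsq : P.halfVar a = 1 / 2 * ((P.σ * a + P.ρ * P.σ₁) ^ 2 + (1 - P.ρ ^ 2) * P.σ₁ ^ 2) := by
    unfold halfVar; ring
  rw [hsq]
  positivity

theorem exists_halfVar_mem_Icc : ∃ δ > 0, ∃ S, ∀ a ∈ Icc 0 P.A, P.halfVar a ∈ Icc δ S := by
  have hcont : ContinuousOn P.halfVar (Icc 0 P.A) := P.continuous_halfVar.continuousOn
  obtain ⟨a, -, ha⟩ := isCompact_Icc.exists_isMinOn P.nonempty_Icc_A hcont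
  obtain ⟨b, -, hb⟩ := isCompact_Icc.exists_isMaxOn P.nonempty_Icc_A hcont
  exact ⟨P.halfVar a, P.halfVar_pos a, P.halfVar b, fun z hz => ⟨ha hz, hb hz⟩⟩

variable {P} {u v a b δ S : ℝ}

theorem optInvestment_mem : P.optInvestment u ∈ Icc 0 P.A :=
  Subtype.coe_prop _

theorem investmentGain_sub_investmentGain (hu : u ≠ 0) :
    P.investmentGain u b - P.investmentGain u a
      = P.σ ^ 2 * u / 2 * ((b - P.critInvestment u) ^ 2 - (a - P.critInvestment u) ^ 2) := by
  have hσ := P.σ_pos.ne'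
  unfold investmentGain halfVar critInvestment
  field_simp
  ring

theorem investmentGain_lt_optInvestment (hu : u < 0) (ha : a ∈ Icc 0 P.A)
    (hne : a ≠ P.optInvestment u) :
    P.investmentGain u a < P.investmentGain u (P.optInvestment u) := by
  rw [← sub_pos, investmentGain_sub_investmentGain hu.ne]
  refine mul_pos_of_neg_of_neg (by nlinarith [sq_pos_of_pos P.σ_pos]) (sub_neg.2 (sq_lt_sq.2 ?_))
  exact abs_projIcc_sub_lt_abs_sub P.A_pos.le ha hne

theorem investmentGain_le_hamiltonian (ha : a ∈ Icc 0 P.A) :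
    P.investmentGain u a ≤ P.hamiltonian u :=
  le_csSup (isCompact_Icc.bddAbove_image (P.continuous_investmentGain u).continuousOn)
    (mem_image_of_mem _ ha)

theorem exists_hamiltonian_eq (P : RiskModel) (u : ℝ) :
    ∃ a ∈ Icc 0 P.A, P.hamiltonian u = P.investmentGain u a :=
  isCompact_Icc.exists_sSup_image_eq P.nonempty_Icc_A (P.continuous_investmentGain u).continuousOn

theorem hamiltonian_eq_optInvestment (hu : u < 0) :
    P.hamiltonian u = P.investmentGain u (P.optInvestment u) := by
  obtain ⟨a, ha, hmax⟩ := P.exists_hamiltonian_eq u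
  by_cases hne : a = P.optInvestment u
  · rw [hmax, hne]
  · exact absurd (investmentGain_lt_optInvestment hu ha hne)
      (hmax ▸ investmentGain_le_hamiltonian optInvestment_mem).not_gt

theorem halfVar_mul_sub_le_hamiltonian_sub (ha : a ∈ Icc 0 P.A)
    (hmax : P.hamiltonian u = P.investmentGain u a) (v : ℝ) :
    P.halfVar a * (v - u) ≤ P.hamiltonian v - P.hamiltonian u := by
  have hv : P.investmentGain v a ≤ P.hamiltonian v := investmentGain_le_hamiltonian ha
  unfold investmentGain at hmax hv
  linarith

theorem hasDerivAt_critInvestment (hu : u ≠ 0) :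
    HasDerivAt P.critInvestment ((P.μ - P.r) / (P.σ ^ 2 * u ^ 2)) u := by
  have hσ := P.σ_pos.ne'
  refine (((hasDerivAt_id u).const_mul (P.σ ^ 2)).fun_inv ?_ |>.const_mul (-(P.μ - P.r))
    |>.sub_const _).congr_deriv ?_
  · exact mul_ne_zero (pow_ne_zero 2 hσ) hu
  · simp only [id]
    field_simp

/-- Danskin's theorem: the maximizer at `u` is unique and depends continuously on `u`. -/
theorem hasDerivAt_hamiltonian (hu : u < 0) :
    HasDerivAt P.hamiltonian (P.halfVar (P.optInvestment u)) u := by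
  have hproj : Continuous fun t => P.halfVar (projIcc 0 P.A P.A_pos.le t) :=
    P.continuous_halfVar.comp (continuous_subtype_val.comp continuous_projIcc)
  refine hasDerivAt_of_continuousAt_subgradient (p := fun v => P.halfVar (P.optInvestment v)) ?_
    (hproj.continuousAt.comp (hasDerivAt_critInvestment hu.ne).continuousAt)
  filter_upwards [gt_mem_nhds hu] with v hv
  exact halfVar_mul_sub_le_hamiltonian_sub optInvestment_mem (hamiltonian_eq_optInvestment hv)

theorem hamiltonian_sub_mem_Icc (hbd : ∀ a ∈ Icc 0 P.A, P.halfVar a ∈ Icc δ S) (huv : u ≤ v) :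
    P.hamiltonian v - P.hamiltonian u ∈ Icc (δ * (v - u)) (S * (v - u)) := by
  obtain ⟨a, ha, hau⟩ := P.exists_hamiltonian_eq u
  obtain ⟨b, hb, hbv⟩ := P.exists_hamiltonian_eq v
  have huv' : 0 ≤ v - u := sub_nonneg.2 huv
  have hlow := halfVar_mul_sub_le_hamiltonian_sub ha hau v
  have hupp := halfVar_mul_sub_le_hamiltonian_sub hb hbv u
  constructor
  · exact (mul_le_mul_of_nonneg_right (hbd a ha).1 huv').trans hlow
  · linarith [mul_le_mul_of_nonneg_right (hbd b hb).2 huv']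

theorem slope_hamiltonian_mem_Icc (hbd : ∀ a ∈ Icc 0 P.A, P.halfVar a ∈ Icc δ S) (hne : u ≠ v) :
    slope P.hamiltonian u v ∈ Icc δ S := by
  wlog huv : u < v generalizing u v
  · rw [slope_comm]
    exact this hne.symm (hne.lt_or_gt.resolve_left huv)
  have hmem := hamiltonian_sub_mem_Icc hbd huv.le
  rw [slope_def_field]
  exact ⟨(le_div_iff₀ (sub_pos.2 huv)).2 hmem.1, (div_le_iff₀ (sub_pos.2 huv)).2 hmem.2⟩

theorem dslope_hamiltonian_mem_Icc (hbd : ∀ a ∈ Icc 0 P.A, P.halfVar a ∈ Icc δ S) (hu : u < 0)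
    (v : ℝ) : dslope P.hamiltonian u v ∈ Icc δ S := by
  rcases eq_or_ne v u with rfl | hne
  · rw [dslope_same, (hasDerivAt_hamiltonian hu).deriv]
    exact hbd _ optInvestment_mem
  · rw [dslope_of_ne _ hne]
    exact slope_hamiltonian_mem_Icc hbd hne.symm

variable {F : Measure ℝ} {V : ℝ → ℝ} {x k m : ℝ}

theorem gen_eq_add_sub_claimDrop : P.gen F a V x = P.halfVar a * D2 V x
    + (P.c + (P.μ - P.r) * a + P.r * x) * D1 V x - P.lam * claimDrop F V x :=
  rfl

theorem gen_eq_mul_investmentGain (hD : D1 V x ≠ 0) : P.gen F a V x = D1 V x *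
    (P.investmentGain (D2 V x / D1 V x) a + (P.c + P.r * x
      - P.lam * (claimDrop F V x / D1 V x))) := by
  rw [gen_eq_add_sub_claimDrop, investmentGain]
  field_simp
  ring

theorem aCrit_eq_critInvestment (P : RiskModel) (V : ℝ → ℝ) (x : ℝ) :
    P.aCrit V x = P.critInvestment (D2 V x / D1 V x) := by
  rw [aCrit, critInvestment, ← neg_mul, ← mul_div_assoc (P.σ ^ 2), div_div_eq_mul_div]

theorem q_eq_critInvestment (P : RiskModel) (m : ℝ) : P.q m = P.critInvestment (-m⁻¹) := by
  rw [q, critInvestment, mul_neg, neg_div_neg_eq, div_mul_eq_div_div, div_inv_eq_mul,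
    div_mul_eq_mul_div]

theorem aStar_eq_projIcc (hD2 : D2 V x < 0) :
    P.aStar V x = projIcc 0 P.A P.A_pos.le (P.aCrit V x) := by
  rw [aStar, if_pos hD2]
  split_ifs with hle hge
  · rw [projIcc_of_le_left _ hle]
  · rw [projIcc_of_right_le _ hge]
  · rw [projIcc_of_mem _ ⟨(not_le.1 hle).le, (not_le.1 hge).le⟩]

theorem aStar_eq_optInvestment (hD2 : D2 V x < 0) :
    P.aStar V x = P.optInvestment (D2 V x / D1 V x) := by
  rw [aStar_eq_projIcc hD2, aCrit_eq_critInvestment, optInvestment]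

theorem gen_lt_gen_aStar (hD : 0 < D1 V x) (hD2 : D2 V x < 0) (ha : a ∈ Icc 0 P.A)
    (hne : a ≠ P.aStar V x) : P.gen F a V x < P.gen F (P.aStar V x) V x := by
  rw [aStar_eq_optInvestment hD2] at hne ⊢
  rw [gen_eq_mul_investmentGain hD.ne', gen_eq_mul_investmentGain hD.ne']
  gcongr
  exact investmentGain_lt_optInvestment (div_neg_of_neg_of_pos hD2 hD) ha hne

theorem abs_aStar_sub_le (hD2 : D2 V x < 0) (hb : b ∈ Icc 0 P.A) :
    |P.aStar V x - b| ≤ |P.aCrit V x - b| := by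
  have hle := abs_projIcc_sub_projIcc P.A_pos.le (c := P.aCrit V x) (d := b)
  rwa [projIcc_of_mem _ hb, ← aStar_eq_projIcc hD2] at hle

namespace IsHJBSolution

theorem hasDerivAt (hV : P.IsHJBSolution F V) (hx : 0 < x) : HasDerivAt V (D1 V x) x :=
  (hV.contDiffOn.differentiableOn two_ne_zero x hx.le).hasDerivWithinAt.hasDerivAt
    (Ici_mem_nhds hx)

theorem contDiffOn_D1 (hV : P.IsHJBSolution F V) : ContDiffOn ℝ 1 (D1 V) (Ici 0) :=
  hV.contDiffOn.derivWithin (uniqueDiffOn_Ici 0) (by norm_num)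

theorem hasDerivAt_D1 (hV : P.IsHJBSolution F V) (hx : 0 < x) :
    HasDerivAt (D1 V) (D2 V x) x :=
  (hV.contDiffOn_D1.differentiableOn one_ne_zero x hx.le).hasDerivWithinAt.hasDerivAt
    (Ici_mem_nhds hx)

theorem gen_nonpos (hV : P.IsHJBSolution F V) (hx : 0 ≤ x) (ha : a ∈ Icc 0 P.A) :
    P.gen F a V x ≤ 0 :=
  (hV.hjb x hx).1 (mem_image_of_mem _ ha)

/-- Were `V''(z) ≤ 0` at a zero `z` of `V'`, every `𝓛^{(a)} V (z)` would be at most `-λ` times the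
expected drop of `V`, which is positive because `V` increases up to `z`. -/
theorem D1_pos (hk : 0 < k) (hV : P.IsHJBSolution (expMeasure k) V) (hx : 0 ≤ x) :
    0 < D1 V x := by
  refine pos_of_deriv_pos_at_first_zero hV.contDiffOn_D1.continuousOn
    (fun z hz => hV.hasDerivAt_D1 hz) (hV.deriv_zero ▸ one_pos) (fun z hz hpos hzero => ?_) hx
  by_contra! hD2
  have hdrop : 0 < P.lam * claimDrop (expMeasure k) V z :=
    mul_pos P.lam_pos (claimDrop_expMeasure_pos hk hV.contDiffOn.continuousOn hV.zero
      (fun y hy => hV.hasDerivAt hy) hz fun y hy => hpos y ⟨hy.1.le, hy.2⟩)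
  have hle : 0 ≤ -(P.lam * claimDrop (expMeasure k) V z) := by
    refine (hV.hjb z hz.le).2 (forall_mem_image.2 fun a _ => ?_)
    rw [gen_eq_add_sub_claimDrop, hzero, mul_zero, add_zero, sub_le_iff_le_add, neg_add_cancel]
    exact mul_nonpos_of_nonneg_of_nonpos (P.halfVar_pos a).le hD2
  linarith

theorem lam_mul_claimDrop_div_D1 (hV : P.IsHJBSolution F V) (hx : 0 ≤ x) (hD : 0 < D1 V x) :
    P.lam * (claimDrop F V x / D1 V x) =
      P.hamiltonian (D2 V x / D1 V x) + (P.c + P.r * x) := by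
  set u := D2 V x / D1 V x
  set K := P.c + P.r * x - P.lam * (claimDrop F V x / D1 V x)
  have hgen : ∀ a, P.gen F a V x = D1 V x * (P.investmentGain u a + K) := fun a =>
    gen_eq_mul_investmentGain hD.ne'
  have hle : P.hamiltonian u + K ≤ 0 := by
    obtain ⟨a, ha, hmax⟩ := P.exists_hamiltonian_eq u
    have hnonpos := hV.gen_nonpos hx ha
    rw [hgen] at hnonpos
    exact hmax ▸ nonpos_of_mul_nonpos_right hnonpos hD
  have hge : 0 ≤ D1 V x * (P.hamiltonian u + K) := by
    refine (hV.hjb x hx).2 (forall_mem_image.2 fun a ha => (hgen a).trans_le ?_)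
    gcongr
    exact investmentGain_le_hamiltonian ha
  linarith [nonneg_of_mul_nonneg_right hge hD]

theorem hasDerivAt_claimDrop_div_D1 (hk : 0 < k) (hV : P.IsHJBSolution (expMeasure k) V)
    (hx : 0 < x) : HasDerivAt (fun x => claimDrop (expMeasure k) V x / D1 V x)
      (1 - claimDrop (expMeasure k) V x / D1 V x * (D2 V x / D1 V x + k)) x := by
  have hD : D1 V x ≠ 0 := (hV.D1_pos hk hx.le).ne'
  refine ((hasDerivAt_claimDrop_expMeasure hk hV.contDiffOn.continuousOn hx
    (hV.hasDerivAt hx)).fun_div (hV.hasDerivAt_D1 hx) hD).congr_deriv ?_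
  field_simp
  ring

theorem isTrackingSystem (hk : 0 < k) (hV : P.IsHJBSolution (expMeasure k) V)
    (hbd : ∀ a ∈ Icc 0 P.A, P.halfVar a ∈ Icc δ S) :
    IsTrackingSystem P.lam P.r (P.c + P.hamiltonian (-k)) δ S
      (fun x => claimDrop (expMeasure k) V x / D1 V x) (fun x => D2 V x / D1 V x + k)
      (fun x => dslope P.hamiltonian (-k) (D2 V x / D1 V x)) where
  hasDerivAt := (eventually_gt_atTop 0).mono fun _ hx => hV.hasDerivAt_claimDrop_div_D1 hk hx
  pos := (eventually_gt_atTop 0).mono fun x hx =>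
    div_pos (claimDrop_expMeasure_pos hk hV.contDiffOn.continuousOn hV.zero
      (fun _ hy => hV.hasDerivAt hy) hx fun _ hy => hV.D1_pos hk hy.1.le) (hV.D1_pos hk hx.le)
  balance := (eventually_ge_atTop 0).mono fun x hx => by
    have hslope := sub_smul_dslope P.hamiltonian (-k) (D2 V x / D1 V x)
    rw [smul_eq_mul, sub_neg_eq_add] at hslope
    linarith [hV.lam_mul_claimDrop_div_D1 hx (hV.D1_pos hk hx)]
  slope_mem := .of_forall fun _ => dslope_hamiltonian_mem_Icc hbd (neg_neg_of_pos hk) _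

theorem tendsto_D2_div_D1 (hk : 0 < k) (hV : P.IsHJBSolution (expMeasure k) V) :
    Tendsto (fun x => D2 V x / D1 V x) atTop (𝓝 (-k)) := by
  obtain ⟨δ, hδ, S, hbd⟩ := P.exists_halfVar_mem_Icc
  simpa using ((hV.isTrackingSystem hk hbd).tendsto_zero P.lam_pos P.r_pos hδ).sub_const k

theorem tendsto_mul_D2_div_D1_add (hk : 0 < k) (hV : P.IsHJBSolution (expMeasure k) V) :
    Tendsto (fun x => x * (D2 V x / D1 V x + k)) atTop (𝓝 (P.lam / P.r - 1)) := by
  obtain ⟨δ, hδ, S, hbd⟩ := P.exists_halfVar_mem_Icc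
  have hcont : ContinuousAt (dslope P.hamiltonian (-k)) (-k) := continuousAt_dslope_same.2
    (hasDerivAt_hamiltonian (neg_neg_of_pos hk)).differentiableAt
  exact (hV.isTrackingSystem hk hbd).tendsto_mul P.lam_pos P.r_pos hδ
    (hcont.tendsto.comp (hV.tendsto_D2_div_D1 hk))

theorem eventually_D2_neg (hk : 0 < k) (hV : P.IsHJBSolution (expMeasure k) V) :
    ∀ᶠ x in atTop, D2 V x < 0 := by
  filter_upwards [(hV.tendsto_D2_div_D1 hk).eventually_lt_const (neg_neg_of_pos hk),
    eventually_ge_atTop 0] with x hu hx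
  exact neg_of_div_neg_left hu (hV.D1_pos hk hx).le

theorem tendsto_mul_aCrit_sub (hm : 0 < m) (hV : P.IsHJBSolution (expMeasure m⁻¹) V) :
    Tendsto (fun x => x * (P.aCrit V x - P.q m)) atTop
      (𝓝 ((P.lam / P.r - 1) * ((P.μ - P.r) * m ^ 2 / P.σ ^ 2))) := by
  have hk : 0 < m⁻¹ := inv_pos.2 hm
  have hlim := tendsto_mul_comp_sub
    (hasDerivAt_critInvestment (P := P) (neg_ne_zero.2 hk.ne')) (hV.tendsto_D2_div_D1 hk)
    (by simpa using hV.tendsto_mul_D2_div_D1_add hk)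
  rw [show (P.μ - P.r) / (P.σ ^ 2 * (-m⁻¹) ^ 2) = (P.μ - P.r) * m ^ 2 / P.σ ^ 2 by
    field_simp] at hlim
  simpa only [aCrit_eq_critInvestment, q_eq_critInvestment] using hlim

theorem aCrit_sub_isBigO (hm : 0 < m) (hV : P.IsHJBSolution (expMeasure m⁻¹) V) :
    (fun x => P.aCrit V x - P.q m) =O[atTop] fun x => 1 / x := by
  refine (((hV.tendsto_mul_aCrit_sub hm).isBigO_one ℝ).mul
    (isBigO_refl (fun x => 1 / x) atTop)).congr' ?_ (by simp)
  filter_upwards [eventually_gt_atTop 0] with x hx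
  field_simp

theorem aCrit_sub_isLittleO (hm : 0 < m) (hV : P.IsHJBSolution (expMeasure m⁻¹) V) :
    (fun x => P.aCrit V x -
        (P.q m - (1 - P.lam / P.r) * ((P.μ - P.r) * m ^ 2 / P.σ ^ 2) * (1 / x)))
      =o[atTop] fun x => 1 / x := by
  have hlim := tendsto_sub_nhds_zero_iff.2 (hV.tendsto_mul_aCrit_sub hm)
  refine (((isLittleO_one_iff ℝ).2 hlim).mul_isBigO
    (isBigO_refl (fun x => 1 / x) atTop)).congr' ?_ (by simp)
  filter_upwards [eventually_gt_atTop 0] with x hx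
  rw [sub_mul, mul_right_comm, mul_one_div_cancel hx.ne']
  ring

theorem tendsto_aCrit (hm : 0 < m) (hV : P.IsHJBSolution (expMeasure m⁻¹) V) :
    Tendsto (P.aCrit V) atTop (𝓝 (P.q m)) :=
  tendsto_sub_nhds_zero_iff.1 ((hV.aCrit_sub_isBigO hm).trans_tendsto
    (by simpa using tendsto_inv_atTop_zero (𝕜 := ℝ)))

end IsHJBSolution

end RiskModel

theorem mainTheorem8 (P : RiskModel) (m : ℝ) (hm : 0 < m) (V : ℝ → ℝ)
    (hV : P.IsHJBSolution (expMeasure m⁻¹) V) :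
    -- for large surplus, `a*_V(x)` is the unique maximizer in the HJB equation
    (∀ᶠ x in atTop, P.aStar V x ∈ Icc 0 P.A ∧
      ∀ a ∈ Icc 0 P.A, a ≠ P.aStar V x →
        P.gen (expMeasure m⁻¹) a V x < P.gen (expMeasure m⁻¹) (P.aStar V x) V x) ∧
    (0 ≤ P.q m → P.q m ≤ P.A →
      (fun x => P.aStar V x - P.q m) =O[atTop] (fun x => 1 / x)) ∧
    (P.q m < 0 → ∀ᶠ x in atTop, P.aStar V x = 0) ∧
    (P.A < P.q m → ∀ᶠ x in atTop, P.aStar V x = P.A) ∧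
    (0 < P.q m → P.q m < P.A →
      (fun x => P.aStar V x -
          (P.q m - (1 - P.lam / P.r) * ((P.μ - P.r) * m ^ 2 / P.σ ^ 2) * (1 / x)))
        =o[atTop] (fun x => 1 / x)) := by
  have hk : 0 < m⁻¹ := inv_pos.2 hm
  have hD2 := hV.eventually_D2_neg hk
  have hlim := hV.tendsto_aCrit hm
  refine ⟨?_, fun h₀ hA => ?_, fun hq => ?_, fun hq => ?_, fun h₀ hA => ?_⟩
  · filter_upwards [hD2, eventually_ge_atTop 0] with x hx hx₀
    refine ⟨RiskModel.aStar_eq_projIcc hx ▸ Subtype.coe_prop _, fun a ha hne => ?_⟩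
    exact RiskModel.gen_lt_gen_aStar (hV.D1_pos hk hx₀) hx ha hne
  · refine IsBigO.trans (.of_bound' ?_) (hV.aCrit_sub_isBigO hm)
    exact hD2.mono fun x hx => RiskModel.abs_aStar_sub_le hx ⟨h₀, hA⟩
  · filter_upwards [hD2, hlim.eventually_lt_const hq] with x hx hcrit
    rw [RiskModel.aStar_eq_projIcc hx, projIcc_of_le_left _ hcrit.le]
  · filter_upwards [hD2, hlim.eventually_const_lt hq] with x hx hcrit
    rw [RiskModel.aStar_eq_projIcc hx, projIcc_of_right_le _ hcrit.le]
  · refine (hV.aCrit_sub_isLittleO hm).congr' ?_ .rfl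
    filter_upwards [hD2, hlim.eventually_const_lt h₀, hlim.eventually_lt_const hA]
      with x hx hpos hlt
    rw [RiskModel.aStar_eq_projIcc hx, projIcc_of_mem _ ⟨hpos.le, hlt.le⟩]
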